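/- Let $\Theta\subseteq\mathbb R^d$ be open, connected and non-empty, and let $\psi:\Theta\to\mathbb R^n$ be a locally isometric embedding, i.e. a smooth topological embedding whose differential preserves inner products at every point. Let $\mathcal M=\psi(\Theta)$ with the induced (flat) Riemannian metric and Riemannian volume $\mathrm{vol}$, and let $\theta^i=x^i\circ\psi^{-1}:\mathcal M\to\mathbb R$, $i=1,\dots,d$, be the isometric coordinates. Let $\mu$ be a probability measure on $\mathcal M$ with an everywhere positive density with respect to $\mathrm{vol}$. For $p\in\mathcal M$ let $\mathrm{Hess}_f(p)$ be the Hessian at $p$ of a function $f$ on $\mathcal M$ in tangent coordinates, i.e. the second derivative at $p$ of $f\circ\pi_p^{-1}$, where $\pi_p$ is the orthogonal projection of a neighbourhood of $p$ in $\mathcal M$ to the affine tangent space $T_p\mathcal M\subset\mathbb R^n$; if $f$ has only weak derivatives up to order two, $f$ is replaced here by its second-order jet at $p$ (this defines $\mathrm{Hess}_f(p)$ for almost every $p$). Let $\nu$ be either $\mathrm{vol}$ or $\mu$, and let $W^{2,2}(\mathcal M)$ be the space of (classes of) functions in $L^2(\nu)$ that have weak derivatives up to order two and whose gradient and Hessian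 have norms in $L^2(\nu)$. Put $$\mathcal H^{\mathcal M}(f)=\int_{\mathcal M}\|\mathrm{Hess}_f(p)\|_F^2\,d\mu(p)\in[0,\infty],\qquad \ker\mathcal H^{\mathcal M}=\{f\in W^{2,2}(\mathcal M):\mathcal H^{\mathcal M}(f)=0\}.$$ Then: 1. A function $f\in W^{2,2}(\mathcal M)$ satisfies $\mathcal H^{\mathcal M}(f)=0$ if and only if there are $a,b_1,\dots,b_d\in\mathbb R$ with $f=a+\sum_i b_i\theta^i$ almost everywhere. 2. If the constants and the coordinates $\theta^i$ are square integrable, i.e. $\int_{\mathcal M}(1+\sum_i(\theta^i)^2)\,d\nu<\infty$ (for example if $\Theta$ is bounded), then $\ker\mathcal H^{\mathcal M}$ is a linear subspace of dimension $d+1$, spanned by the constant function $1$ and the isometric coordinates $\theta^1,\dots,\theta^d$. -/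

import Mathlib

open MeasureTheory Topology Filter
open scoped ENNReal ContDiff

noncomputable section

namespace HessianForm

/-- Euclidean space `ℝ^k`. -/
abbrev E (k : ℕ) := EuclideanSpace ℝ (Fin k)

variable {d n : ℕ}

/-- The `i`-th standard basis vector of `ℝ^k`. -/
def stdVec {k : ℕ} (i : Fin k) : E k := EuclideanSpace.single i (1 : ℝ)

/-! ### The manifold `M = ψ(Θ)` -/

/-- `ψ : Θ → ℝ^n` is a locally isometric embedding: a smooth map which is a homeomorphism onto its
image and whose differential preserves inner products. -/
structure IsLocallyIsometricEmbedding (Θ : Set (E d)) (ψ : E d → E n) : Prop where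
  contDiffOn : ContDiffOn ℝ ∞ ψ Θ
  isEmbedding : IsEmbedding (Θ.domRestrict ψ)
  inner_fderiv : ∀ x ∈ Θ, ∀ v w : E d,
    inner ℝ (fderiv ℝ ψ x v) (fderiv ℝ ψ x w) = inner ℝ v w

/-- The isometric coordinates `θ = ψ⁻¹ : M → Θ`; the `i`-th one is `p ↦ isoCoord Θ ψ p i`. -/
def isoCoord (Θ : Set (E d)) (ψ : E d → E n) : E n → E d := Function.invFunOn ψ Θ

/-- The matrix `g_ij = ⟨∂_i ψ, ∂_j ψ⟩` of the metric induced on `M` by `ℝ^n`, in the coordinates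
given by `ψ`. -/
def gramMatrix (ψ : E d → E n) (x : E d) : Matrix (Fin d) (Fin d) ℝ :=
  Matrix.of fun i j => inner ℝ (fderiv ℝ ψ x (stdVec i)) (fderiv ℝ ψ x (stdVec j))

/-- The Riemannian volume measure `√(det g) dx` of `M = ψ(Θ)`, as a measure on `ℝ^n` carried
by `M`. -/
def riemVolume (Θ : Set (E d)) (ψ : E d → E n) : Measure (E n) :=
  ((volume.restrict Θ).withDensity fun x => ENNReal.ofReal √(gramMatrix ψ x).det).map ψ

/-! ### Tangent coordinates -/

/-- The tangent space `T_p M`, as a linear subspace of `ℝ^n`. -/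
def tangentSubspace (Θ : Set (E d)) (ψ : E d → E n) (p : E n) : Submodule ℝ (E n) :=
  LinearMap.range (fderiv ℝ ψ (isoCoord Θ ψ p)).toLinearMap

/-- The orthogonal projection `π_p` onto the affine tangent space at `p`, which is identified with
the vector space `T_p M` by taking `p` as the origin. -/
def tangentProj (Θ : Set (E d)) (ψ : E d → E n) (p q : E n) : tangentSubspace Θ ψ p :=
  (tangentSubspace Θ ψ p).orthogonalProjectionOnto (q - p)

/-- `s` is, near the origin of `T_p M`, the inverse of the projection `π_p : U_p → T_p M` of a
neighbourhood `U_p` of `p` in `M`. This determines the germ of `s` at the origin. -/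
structure IsTangentParam (Θ : Set (E d)) (ψ : E d → E n) (p : E n)
    (s : tangentSubspace Θ ψ p → E n) : Prop where
  map_zero : s 0 = p
  continuousAt : ContinuousAt s 0
  eventually_mem : ∀ᶠ v in 𝓝 0, s v ∈ ψ '' Θ
  eventually_proj : ∀ᶠ v in 𝓝 0, tangentProj Θ ψ p (s v) = v

open Classical in
/-- The inverse `π_p⁻¹` of the tangent coordinates around `p`. -/
def tangentParam (Θ : Set (E d)) (ψ : E d → E n) (p : E n) : tangentSubspace Θ ψ p → E n :=
  if h : ∃ s, IsTangentParam Θ ψ p s then h.choose else fun _ => p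

/-- The differential at `p` of a function `f` on `M`, in tangent coordinates. -/
def tanDeriv (Θ : Set (E d)) (ψ : E d → E n) (f : E n → ℝ) (p : E n) :
    tangentSubspace Θ ψ p →L[ℝ] ℝ :=
  fderiv ℝ (f ∘ tangentParam Θ ψ p) 0

/-- The Hessian `Hess_f^tan(p)` of a (twice differentiable) function `f` on `M`: the second
derivative, at the origin, of `f` written in the tangent coordinates around `p`. -/
def tanHess (Θ : Set (E d)) (ψ : E d → E n) (f : E n → ℝ) (p : E n) :
    tangentSubspace Θ ψ p →L[ℝ] tangentSubspace Θ ψ p →L[ℝ] ℝ :=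
  fderiv ℝ (fderiv ℝ (f ∘ tangentParam Θ ψ p)) 0

/-- The squared Frobenius norm of a bilinear form on a Euclidean space: the sum of the squares of
its entries in an orthonormal basis. -/
def frobSq {V : Type*} [NormedAddCommGroup V] [InnerProductSpace ℝ V] [FiniteDimensional ℝ V]
    (B : V →L[ℝ] V →L[ℝ] ℝ) : ℝ :=
  ∑ a, ∑ b, (B (stdOrthonormalBasis ℝ V a) (stdOrthonormalBasis ℝ V b)) ^ 2

/-! ### Weak derivatives -/

/-- `v` is the weak partial derivative `∂_i u` on the open set `Θ`. -/
structure IsWeakPartial (Θ : Set (E d)) (i : Fin d) (u v : E d → ℝ) : Prop where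
  locallyIntegrableOn : LocallyIntegrableOn u Θ
  locallyIntegrableOn_deriv : LocallyIntegrableOn v Θ
  integral_eq : ∀ φ : E d → ℝ, ContDiff ℝ ∞ φ → HasCompactSupport φ → tsupport φ ⊆ Θ →
    ∫ x in Θ, u x * fderiv ℝ φ x (stdVec i) = -∫ x in Θ, v x * φ x

/-- `u` has a weak partial derivative `∂_i u` on `Θ`. -/
def HasWeakPartial (Θ : Set (E d)) (i : Fin d) (u : E d → ℝ) : Prop :=
  ∃ v, IsWeakPartial Θ i u v

open Classical in
/-- The weak partial derivative `∂_i u` on `Θ` (unique almost everywhere on `Θ`); zero if there is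
none. -/
def weakPartial (Θ : Set (E d)) (i : Fin d) (u : E d → ℝ) : E d → ℝ :=
  if h : HasWeakPartial Θ i u then h.choose else 0

/-- The second-order jet at `p ∈ M` of a function `f` on `M` with weak derivatives up to order two:
the polynomial of degree two in the isometric coordinates with the same value and the same (weak)
derivatives of order one and two at `p` as `f`. -/
def jet (Θ : Set (E d)) (ψ : E d → E n) (f : E n → ℝ) (p q : E n) : ℝ :=
  f p
    + ∑ i, weakPartial Θ i (f ∘ ψ) (isoCoord Θ ψ p) * (isoCoord Θ ψ q i - isoCoord Θ ψ p i)
    + 1 / 2 * ∑ i, ∑ j, weakPartial Θ j (weakPartial Θ i (f ∘ ψ)) (isoCoord Θ ψ p)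
        * (isoCoord Θ ψ q i - isoCoord Θ ψ p i) * (isoCoord Θ ψ q j - isoCoord Θ ψ p j)

/-- The differential of a weakly differentiable function `f` on `M` at (almost every) `p`. The
differential at `p` depends only on the jet of `f` at `p`. -/
def weakTanDeriv (Θ : Set (E d)) (ψ : E d → E n) (f : E n → ℝ) (p : E n) :
    tangentSubspace Θ ψ p →L[ℝ] ℝ :=
  tanDeriv Θ ψ (jet Θ ψ f p) p

/-- The Hessian `Hess_f^tan(p)` of a twice weakly differentiable function `f` on `M` at (almost
every) `p`. The Hessian at `p` depends only on the second-order jet of `f` at `p`. -/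
def weakTanHess (Θ : Set (E d)) (ψ : E d → E n) (f : E n → ℝ) (p : E n) :
    tangentSubspace Θ ψ p →L[ℝ] tangentSubspace Θ ψ p →L[ℝ] ℝ :=
  tanHess Θ ψ (jet Θ ψ f p) p

/-! ### The Sobolev space and the quadratic form -/

/-- The Sobolev space `W^{2,2}(M)`: the functions in `L²` with weak derivatives up to order two
whose gradient and Hessian are in `L²`. Square integrability refers to the measure `ν` on `M`. -/
def W22 (Θ : Set (E d)) (ψ : E d → E n) (ν : Measure (E n)) : Set (Lp ℝ 2 ν) :=
  {f | (∀ i, HasWeakPartial Θ i (f ∘ ψ)) ∧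
    (∀ i j, HasWeakPartial Θ j (weakPartial Θ i (f ∘ ψ))) ∧
    ∫⁻ p, ENNReal.ofReal (‖weakTanDeriv Θ ψ f p‖ ^ 2) ∂ν < ⊤ ∧
    ∫⁻ p, ENNReal.ofReal (frobSq (weakTanHess Θ ψ f p)) ∂ν < ⊤}

/-- The form `H^M(f) = ∫_M ‖Hess_f^tan(p)‖_F² dμ(p)`, with values in `[0, ∞]`. -/
def hessForm (Θ : Set (E d)) (ψ : E d → E n) (μ : Measure (E n)) (f : E n → ℝ) : ℝ≥0∞ :=
  ∫⁻ p, ENNReal.ofReal (frobSq (weakTanHess Θ ψ f p)) ∂μ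

/-- The null space of `H^M` on `W^{2,2}(M)`. -/
def nullSpace (Θ : Set (E d)) (ψ : E d → E n) (ν μ : Measure (E n)) : Set (Lp ℝ 2 ν) :=
  {f | f ∈ W22 Θ ψ ν ∧ hessForm Θ ψ μ f = 0}

end HessianForm

end

namespace HessianForm

/-! ### Weak derivatives on an open set; vanishing weak gradients and Hessians -/

section WeakDerivatives

variable {d : ℕ} {Θ : Set (E d)}

/-! The point is that, for a flat embedding, tangent coordinates at `p` agree with the isometric
coordinates to second order, up to an isometry. Differentiating `⟨∂_b ψ, ∂_c ψ⟩ = const` shows that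
the second derivative of `ψ` is normal to `M` (`inner_fderiv_fderiv_eq_zero`). The orthogonal
projection `π_p` kills normal vectors, so `π_p ∘ ψ` has zero second derivative at `θ(p)`, while its
first derivative there is an isometry onto `T_p M`. Its local inverse `θ ∘ π_p⁻¹` therefore also has
zero second derivative at the origin (`IsTangentParam.fderiv_fderiv_isoCoord`). Hence the tangent
Hessian of the jet of `f` is the symmetrised matrix of second weak partials of `f ∘ ψ`, transported
by an isometry (`weakTanHess_apply`).

The Gram matrix is the identity, so the volume of `M` is the image of Lebesgue measure on `Θ`. By
positivity of the density, `μ` and `ν` have the same null sets. Since weak second derivatives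
commute (`IsWeakPartial.second_symm`), the form vanishes exactly when all second weak partials of `f
∘ ψ` vanish almost everywhere. On a connected open set a function with zero weak gradient is
constant (`exists_ae_eq_const_of_isWeakPartial_zero`); applied to the first partials, and then to `f
∘ ψ` minus its linear part, this makes `f ∘ ψ` affine. The dimension is `d + 1` because an affine
function vanishing almost everywhere on a nonempty open set has zero coefficients. -/

theorem integrable_mul_of_tsupport_subset {u φ : E d → ℝ}
    (hu : LocallyIntegrableOn u Θ) (hφ : Continuous φ) (hc : HasCompactSupport φ)
    (hs : tsupport φ ⊆ Θ) : Integrable (fun x => u x * φ x) := by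
  have h1 : IntegrableOn u (tsupport φ) :=
    hu.integrableOn_compact_subset hs hc
  have h2 : IntegrableOn (fun x => u x * φ x) (tsupport φ) :=
    h1.mul_continuousOn hφ.continuousOn hc
  refine (integrableOn_iff_integrable_of_support_subset ?_).1 h2
  intro x hx
  refine subset_tsupport φ ?_
  simp only [Function.mem_support] at hx ⊢
  exact fun h => hx (by simp [h])

theorem setIntegral_mul_of_tsupport_subset {u φ : E d → ℝ} (hs : tsupport φ ⊆ Θ) :
    ∫ x in Θ, u x * φ x = ∫ x, u x * φ x := by
  refine setIntegral_eq_integral_of_forall_compl_eq_zero fun x hx => ?_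
  rw [image_eq_zero_of_notMem_tsupport fun h => hx (hs h), mul_zero]

theorem contDiff_fderiv_apply {φ : E d → ℝ} (hφ : ContDiff ℝ ∞ φ) (v : E d) :
    ContDiff ℝ ∞ fun x => fderiv ℝ φ x v :=
  (hφ.fderiv_right (m := ∞) (by simp)).clm_apply contDiff_const

theorem tsupport_fderiv_apply_subset_of_subset {φ : E d → ℝ} (hs : tsupport φ ⊆ Θ) (v : E d) :
    tsupport (fun x => fderiv ℝ φ x v) ⊆ Θ :=
  (tsupport_fderiv_apply_subset ℝ v).trans hs

theorem IsWeakPartial.congr {i : Fin d} {u v u' v' : E d → ℝ} (h : IsWeakPartial Θ i u v)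
    (hu : u =ᵐ[volume.restrict Θ] u') (hv : v =ᵐ[volume.restrict Θ] v') :
    IsWeakPartial Θ i u' v' where
  locallyIntegrableOn := h.locallyIntegrableOn.congr hu
  locallyIntegrableOn_deriv := h.locallyIntegrableOn_deriv.congr hv
  integral_eq φ hφ hc hs := by
    have h1 : ∫ x in Θ, u' x * fderiv ℝ φ x (stdVec i) = ∫ x in Θ, u x * fderiv ℝ φ x (stdVec i) :=
      integral_congr_ae (by filter_upwards [hu] with x hx; rw [hx])
    have h2 : ∫ x in Θ, v' x * φ x = ∫ x in Θ, v x * φ x :=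
      integral_congr_ae (by filter_upwards [hv] with x hx; rw [hx])
    rw [h1, h2, h.integral_eq φ hφ hc hs]

theorem ae_eq_of_integral_testFunction_eq (hΘ : IsOpen Θ) {v w : E d → ℝ}
    (hv : LocallyIntegrableOn v Θ) (hw : LocallyIntegrableOn w Θ)
    (h : ∀ φ : E d → ℝ, ContDiff ℝ ∞ φ → HasCompactSupport φ → tsupport φ ⊆ Θ →
      ∫ x in Θ, v x * φ x = ∫ x in Θ, w x * φ x) : v =ᵐ[volume.restrict Θ] w := by
  have := hΘ.ae_eq_zero_of_integral_contDiff_smul_eq_zero (μ := volume) (f := v - w)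
    (hv.sub hw) ?_
  · rw [EventuallyEq, ae_restrict_iff' hΘ.measurableSet]
    filter_upwards [this] with x hx hxΘ
    exact sub_eq_zero.1 (hx hxΘ)
  · intro φ hφ hc hs
    have h1 := integrable_mul_of_tsupport_subset hv hφ.continuous hc hs
    have h2 := integrable_mul_of_tsupport_subset hw hφ.continuous hc hs
    have h3 := h φ hφ hc hs
    rw [setIntegral_mul_of_tsupport_subset hs, setIntegral_mul_of_tsupport_subset hs] at h3
    have h4 : (fun x => φ x • (v - w) x) = fun x => v x * φ x - w x * φ x := by
      ext x
      simp only [Pi.sub_apply, smul_eq_mul]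
      ring
    rw [h4, integral_sub h1 h2, h3, sub_self]

theorem IsWeakPartial.ae_unique (hΘ : IsOpen Θ) {i : Fin d} {u v w : E d → ℝ}
    (hv : IsWeakPartial Θ i u v) (hw : IsWeakPartial Θ i u w) : v =ᵐ[volume.restrict Θ] w := by
  refine ae_eq_of_integral_testFunction_eq hΘ hv.2 hw.2 fun φ hφ hc hs => ?_
  have h1 := hv.integral_eq φ hφ hc hs
  rw [hw.integral_eq φ hφ hc hs] at h1
  exact (neg_injective h1).symm

theorem HasWeakPartial.isWeakPartial {i : Fin d} {u : E d → ℝ} (h : HasWeakPartial Θ i u) :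
    IsWeakPartial Θ i u (weakPartial Θ i u) := by
  rw [weakPartial, dif_pos h]
  exact h.choose_spec

theorem IsWeakPartial.weakPartial_ae_eq (hΘ : IsOpen Θ) {i : Fin d} {u v : E d → ℝ}
    (h : IsWeakPartial Θ i u v) : weakPartial Θ i u =ᵐ[volume.restrict Θ] v :=
  (HasWeakPartial.isWeakPartial ⟨v, h⟩).ae_unique hΘ h

/-- Integrating by parts twice moves both derivatives onto a test function, where they commute. This
is needed because the tangent Hessian only sees the symmetrised matrix of second weak partials. -/
theorem IsWeakPartial.second_symm (hΘ : IsOpen Θ) {i j : Fin d} {u vi vj vij vji : E d → ℝ}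
    (hi : IsWeakPartial Θ i u vi) (hj : IsWeakPartial Θ j u vj) (hij : IsWeakPartial Θ j vi vij)
    (hji : IsWeakPartial Θ i vj vji) : vij =ᵐ[volume.restrict Θ] vji := by
  refine ae_eq_of_integral_testFunction_eq hΘ hij.2 hji.2 fun φ hφ hc hs => ?_
  have hD : ∀ k : Fin d, ContDiff ℝ ∞ (fun x => fderiv ℝ φ x (stdVec k)) ∧
      HasCompactSupport (fun x => fderiv ℝ φ x (stdVec k)) ∧
      tsupport (fun x => fderiv ℝ φ x (stdVec k)) ⊆ Θ := fun k =>
    ⟨contDiff_fderiv_apply hφ _, hc.fderiv_apply ℝ _, tsupport_fderiv_apply_subset_of_subset hs _⟩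
  have hcomm : ∀ x, fderiv ℝ (fun y => fderiv ℝ φ y (stdVec j)) x (stdVec i)
      = fderiv ℝ (fun y => fderiv ℝ φ y (stdVec i)) x (stdVec j) := by
    intro x
    have hd : DifferentiableAt ℝ (fderiv ℝ φ) x :=
      (hφ.fderiv_right (m := 1) (by norm_cast)).differentiable (by simp) x
    have hs := (hφ.contDiffAt (x := x)).isSymmSndFDerivAt
      (by rw [minSmoothness_of_isRCLikeNormedField]; norm_cast)
    rw [fderiv_clm_apply hd (by fun_prop), fderiv_clm_apply hd (by fun_prop)]
    simpa using hs.eq (stdVec i) (stdVec j)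
  have e1 := hij.integral_eq φ hφ hc hs
  have e2 := hji.integral_eq φ hφ hc hs
  have e3 := hi.integral_eq _ (hD j).1 (hD j).2.1 (hD j).2.2
  have e4 := hj.integral_eq _ (hD i).1 (hD i).2.1 (hD i).2.2
  simp only [hcomm] at e3
  linarith

theorem isWeakPartial_of_contDiff (i : Fin d) {u : E d → ℝ}
    (hu : ContDiff ℝ ∞ u) : IsWeakPartial Θ i u (fun x => fderiv ℝ u x (stdVec i)) where
  locallyIntegrableOn := (hu.continuous.locallyIntegrable).locallyIntegrableOn _
  locallyIntegrableOn_deriv :=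
    ((contDiff_fderiv_apply hu _).continuous.locallyIntegrable).locallyIntegrableOn _
  integral_eq φ hφ hc hs := by
    have l1 := (hu.continuous.locallyIntegrable (μ := volume)).locallyIntegrableOn Θ
    have l2 := ((contDiff_fderiv_apply hu (stdVec i)).continuous.locallyIntegrable
      (μ := volume)).locallyIntegrableOn Θ
    have hs' := tsupport_fderiv_apply_subset_of_subset hs (stdVec i)
    have hd := (contDiff_fderiv_apply hφ (stdVec i)).continuous
    rw [setIntegral_mul_of_tsupport_subset hs', setIntegral_mul_of_tsupport_subset hs]
    exact integral_mul_fderiv_eq_neg_fderiv_mul_of_integrable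
      (integrable_mul_of_tsupport_subset l2 hφ.continuous hc hs)
      (integrable_mul_of_tsupport_subset l1 hd (hc.fderiv_apply ℝ _) hs')
      (integrable_mul_of_tsupport_subset l1 hφ.continuous hc hs)
      (fun x _ => hu.differentiable (by simp) x) (fun x _ => hφ.differentiable (by simp) x)

theorem contDiff_affine (a : ℝ) (b : Fin d → ℝ) :
    ContDiff ℝ ∞ fun x : E d => a + ∑ i, b i * x i := by
  fun_prop

theorem fderiv_affine (a : ℝ) (b : Fin d → ℝ) (x : E d) (i : Fin d) :
    fderiv ℝ (fun x : E d => a + ∑ i, b i * x i) x (stdVec i) = b i := by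
  have h : HasFDerivAt (fun x : E d => a + ∑ i, b i * x i)
      (∑ i, b i • (EuclideanSpace.proj i : E d →L[ℝ] ℝ)) x := by
    refine HasFDerivAt.const_add _ (HasFDerivAt.fun_sum fun i _ => ?_)
    exact ((EuclideanSpace.proj i : E d →L[ℝ] ℝ).hasFDerivAt).const_mul (b i)
  rw [h.fderiv]
  simp [stdVec]

theorem isWeakPartial_affine (i : Fin d) (a : ℝ) (b : Fin d → ℝ) :
    IsWeakPartial Θ i (fun x => a + ∑ i, b i * x i) (fun _ => b i) := by
  have := isWeakPartial_of_contDiff (Θ := Θ) i (contDiff_affine a b)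
  simpa only [fderiv_affine] using this

theorem isWeakPartial_const (i : Fin d) (a : ℝ) :
    IsWeakPartial Θ i (fun _ => a) (fun _ => 0) := by
  simpa using isWeakPartial_affine i a 0

theorem IsWeakPartial.sub {i : Fin d} {u v u' v' : E d → ℝ}
    (h : IsWeakPartial Θ i u v) (h' : IsWeakPartial Θ i u' v') :
    IsWeakPartial Θ i (fun x => u x - u' x) (fun x => v x - v' x) where
  locallyIntegrableOn := h.1.sub h'.1
  locallyIntegrableOn_deriv := h.2.sub h'.2
  integral_eq φ hφ hc hs := by
    have hs' := tsupport_fderiv_apply_subset_of_subset hs (stdVec i)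
    have hd := (contDiff_fderiv_apply hφ (stdVec i)).continuous
    have hc' := hc.fderiv_apply ℝ (stdVec i)
    simp only [sub_mul]
    rw [integral_sub, integral_sub, h.integral_eq φ hφ hc hs, h'.integral_eq φ hφ hc hs]
    · ring
    · exact (integrable_mul_of_tsupport_subset h.2 hφ.continuous hc hs).integrableOn
    · exact (integrable_mul_of_tsupport_subset h'.2 hφ.continuous hc hs).integrableOn
    · exact (integrable_mul_of_tsupport_subset h.1 hd hc' hs').integrableOn
    · exact (integrable_mul_of_tsupport_subset h'.1 hd hc' hs').integrableOn

/-- The mollification of a function with vanishing weak gradient has vanishing gradient. -/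
theorem hasFDerivAt_convolution_zero {u : E d → ℝ} (hu : LocallyIntegrableOn u Θ)
    (h : ∀ i, IsWeakPartial Θ i u (fun _ => 0)) {x₀ x : E d} {r : ℝ}
    (hr : Metric.closedBall x₀ (2 * r) ⊆ Θ) (hx : x ∈ Metric.ball x₀ r) (η : ContDiffBump (0 : E d))
    (hη : η.rOut < r) :
    HasFDerivAt (convolution (η.normed volume) ((Metric.closedBall x₀ (2 * r)).indicator u)
      (ContinuousLinearMap.lsmul ℝ ℝ) volume) (0 : E d →L[ℝ] ℝ) x := by
  set g := (Metric.closedBall x₀ (2 * r)).indicator u with hg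
  set φ : E d → ℝ := η.normed volume with hφdef
  have hgi : Integrable g :=
    (hu.integrableOn_compact_subset hr (isCompact_closedBall _ _)).integrable_indicator
      measurableSet_closedBall
  have hφ : ContDiff ℝ ∞ φ := η.contDiff_normed
  have hφc : HasCompactSupport φ := η.hasCompactSupport_normed
  have key := hφc.hasFDerivAt_convolution_left (ContinuousLinearMap.lsmul ℝ ℝ)
    (hφ.of_le (by norm_cast)) hgi.locallyIntegrable x
  suffices hzero : convolution (fderiv ℝ φ) g
      (ContinuousLinearMap.precompL (E d) (ContinuousLinearMap.lsmul ℝ ℝ)) volume x = 0 by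
    rwa [hzero] at key
  -- The derivative of the convolution falls on the mollifier, so up to sign it is the integral of
  -- `u` against a partial derivative of `ζ`. As `x` is within `r` of `x₀` and the bump has radius
  -- below `r`, the support of `ζ` lies in the ball of radius `2 * r`, where `g = u`. So `ζ` is an
  -- admissible test function.
  set ζ : E d → ℝ := fun y => φ (x - y) with hζdef
  have hζ : ContDiff ℝ ∞ ζ := hφ.comp (contDiff_const.sub contDiff_id)
  have hζs : tsupport ζ ⊆ Metric.closedBall x η.rOut := by
    refine closure_minimal (fun y hy => ?_) Metric.isClosed_closedBall
    have : x - y ∈ Function.support φ := hy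
    rw [hφdef, η.support_normed_eq] at this
    rw [mem_ball_zero_iff] at this
    rw [Metric.mem_closedBall, dist_comm, dist_eq_norm]
    exact this.le
  have hζB : tsupport ζ ⊆ Metric.closedBall x₀ (2 * r) := by
    refine hζs.trans (Metric.closedBall_subset_closedBall' ?_)
    rw [Metric.mem_ball] at hx
    linarith
  have hζc : HasCompactSupport ζ :=
    HasCompactSupport.of_support_subset_isCompact (isCompact_closedBall x η.rOut)
      (subset_closure.trans hζs)
  have hderiv : ∀ y v, fderiv ℝ ζ y v = - fderiv ℝ φ (x - y) v := by
    intro y v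
    have h1 : HasFDerivAt (fun y => x - y) (-ContinuousLinearMap.id ℝ (E d)) y :=
      (hasFDerivAt_id y).const_sub x
    have h2 : HasFDerivAt φ (fderiv ℝ φ (x - y)) (x - y) :=
      (hφ.differentiable (by simp) _).hasFDerivAt
    have h3 : HasFDerivAt ζ ((fderiv ℝ φ (x - y)).comp (-ContinuousLinearMap.id ℝ (E d))) y :=
      h2.comp y h1
    simp [h3.fderiv]
  have hint : Integrable fun t => ((ContinuousLinearMap.lsmul ℝ ℝ).precompL (E d))
      (fderiv ℝ φ (x - t)) (g t) := by
    have hc : ConvolutionExists g (fderiv ℝ φ)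
        (((ContinuousLinearMap.lsmul ℝ ℝ).precompL (E d)).flip) volume := fun z =>
      (hφc.fderiv ℝ).convolutionExists_right _ hgi.locallyIntegrable
        (hφ.continuous_fderiv (by simp)) z
    exact hc x
  rw [convolution_eq_swap]
  refine ContinuousLinearMap.coe_injective
    ((EuclideanSpace.basisFun (Fin d) ℝ).toBasis.ext fun i => ?_)
  have hi : (EuclideanSpace.basisFun (Fin d) ℝ).toBasis i = stdVec i := by simp [stdVec]
  rw [hi, ContinuousLinearMap.coe_coe, ContinuousLinearMap.integral_apply hint]
  have hz := (h i).integral_eq ζ hζ hζc (hζB.trans hr)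
  rw [setIntegral_mul_of_tsupport_subset
    (tsupport_fderiv_apply_subset_of_subset (hζB.trans hr) _)] at hz
  simp only [zero_mul, integral_zero, neg_zero] at hz
  change _ = (0 : ℝ)
  rw [← neg_eq_zero, ← integral_neg]
  refine Eq.trans (integral_congr_ae (Eventually.of_forall fun y => ?_)) hz
  simp only [ContinuousLinearMap.precompL_apply, ContinuousLinearMap.lsmul_apply, smul_eq_mul]
  by_cases hy : y ∈ Metric.closedBall x₀ (2 * r)
  · rw [hderiv, hg, Set.indicator_of_mem hy]
    ring
  · have : fderiv ℝ ζ y (stdVec i) = 0 := by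
      by_contra hne
      exact hy (hζB (tsupport_fderiv_apply_subset ℝ (stdVec i) (subset_tsupport _ hne)))
    rw [this, hg, Set.indicator_of_notMem hy]
    simp

/-- Mollifications of `u` converge to it almost everywhere, and at small scales each is constant on
the ball. Comparing the limit at almost every point with that at one fixed point of convergence
gives the constant. -/
theorem exists_ae_eq_const_ball {u : E d → ℝ} (hu : LocallyIntegrableOn u Θ)
    (h : ∀ i, IsWeakPartial Θ i u (fun _ => 0)) {x₀ : E d} {r : ℝ} (hr0 : 0 < r)
    (hr : Metric.closedBall x₀ (2 * r) ⊆ Θ) :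
    ∃ c : ℝ, ∀ᵐ x, x ∈ Metric.ball x₀ r → u x = c := by
  set g := (Metric.closedBall x₀ (2 * r)).indicator u with hg
  have hgi : Integrable g :=
    (hu.integrableOn_compact_subset hr (isCompact_closedBall _ _)).integrable_indicator
      measurableSet_closedBall
  -- The outer radius is twice the inner one: the almost everywhere convergence of mollifiers needs
  -- a bounded ratio of radii, here `K = 2`.
  let η : ℕ → ContDiffBump (0 : E d) := fun k =>
    ⟨1 / ((k : ℝ) + 1), 2 * (1 / ((k : ℝ) + 1)), by positivity, by
      have : 0 < 1 / ((k : ℝ) + 1) := by positivity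
      linarith⟩
  have ht : Tendsto (fun k => (η k).rOut) atTop (𝓝 0) := by
    have := (tendsto_one_div_add_atTop_nhds_zero_nat (𝕜 := ℝ)).const_mul 2
    simpa [η] using this
  have hae := ContDiffBump.ae_convolution_tendsto_right_of_locallyIntegrable (μ := volume)
    (K := 2) ht (Eventually.of_forall fun k => le_rfl) hgi.locallyIntegrable
  have hne : ∃ y ∈ Metric.ball x₀ r, Tendsto (fun k => convolution ((η k).normed volume) g
      (ContinuousLinearMap.lsmul ℝ ℝ) volume y) atTop (𝓝 (g y)) := by
    by_contra! hcon
    have : volume (Metric.ball x₀ r) = 0 := by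
      refine measure_mono_null (fun y hy => ?_) hae
      exact hcon y hy
    exact (Metric.measure_ball_pos volume x₀ hr0).ne' this
  obtain ⟨y, hy, hyt⟩ := hne
  refine ⟨g y, ?_⟩
  filter_upwards [hae] with x hxt hx
  have hxg : g x = u x := Set.indicator_of_mem
    (Metric.ball_subset_closedBall (Metric.ball_subset_ball (by linarith) hx)) u
  rw [← hxg]
  refine tendsto_nhds_unique_of_eventuallyEq hxt hyt ?_
  filter_upwards [ht.eventually_lt_const hr0] with k hk
  have hD : ∀ z ∈ Metric.ball x₀ r, HasFDerivAt (convolution ((η k).normed volume) g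
      (ContinuousLinearMap.lsmul ℝ ℝ) volume) (0 : E d →L[ℝ] ℝ) z := fun z hz =>
    hasFDerivAt_convolution_zero hu h hr hz (η k) hk
  exact Metric.isOpen_ball.is_const_of_fderiv_eq_zero (convex_ball x₀ r).isPreconnected
    (fun z hz => (hD z hz).differentiableAt.differentiableWithinAt)
    (fun z hz => (hD z hz).fderiv) hx hy

/-- Local constants at nearby points agree, because the two balls overlap in a nonempty open set,
which has positive measure; connectedness then propagates the value. -/
theorem exists_ae_eq_const_of_isWeakPartial_zero (hΘ : IsOpen Θ) (hconn : IsConnected Θ)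
    {u : E d → ℝ} (hu : LocallyIntegrableOn u Θ) (h : ∀ i, IsWeakPartial Θ i u (fun _ => 0)) :
    ∃ c : ℝ, u =ᵐ[volume.restrict Θ] fun _ => c := by
  have hloc : ∀ x ∈ Θ, ∃ c : ℝ, ∃ r > 0, ∀ᵐ y, y ∈ Metric.ball x r → u y = c := by
    intro x hx
    obtain ⟨r, hr0, hr⟩ := Metric.nhds_basis_closedBall.mem_iff.1 (hΘ.mem_nhds hx)
    obtain ⟨c, hc⟩ := exists_ae_eq_const_ball hu h (half_pos hr0) (x₀ := x)
      (by rwa [mul_div_cancel₀ _ two_ne_zero])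
    exact ⟨c, r / 2, half_pos hr0, hc⟩
  choose! c r hr hc using hloc
  obtain ⟨x₀, hx₀⟩ := hconn.nonempty
  have hcc : ∀ x ∈ Θ, c x = c x₀ := by
    intro x hx
    refine hconn.isPreconnected.induction₂ (fun x y => c x = c y) ?_
      (fun _ _ _ _ _ _ h1 h2 => h1.trans h2) (fun _ _ _ _ h => h.symm) hx hx₀
    intro x hx
    filter_upwards [self_mem_nhdsWithin,
      mem_nhdsWithin_of_mem_nhds (Metric.ball_mem_nhds x (hr x hx))] with y hy hyx
    have hpos : 0 < volume (Metric.ball x (r x) ∩ Metric.ball y (r y)) :=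
      (Metric.isOpen_ball.inter Metric.isOpen_ball).measure_pos volume
        ⟨y, hyx, Metric.mem_ball_self (hr y hy)⟩
    by_contra hne
    refine hpos.ne' (measure_mono_null ?_ ((hc x hx).and (hc y hy)))
    intro z hz hz'
    exact hne ((hz'.1 hz.1).symm.trans (hz'.2 hz.2))
  refine ⟨c x₀, ?_⟩
  rw [EventuallyEq, ae_restrict_iff' hΘ.measurableSet, ae_iff]
  refine measure_null_of_locally_null _ fun x hx => ?_
  simp only [Set.mem_ofPred_eq, Classical.not_imp] at hx
  refine ⟨_, inter_mem_nhdsWithin _ (Metric.ball_mem_nhds x (hr x hx.1)), ?_⟩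
  refine measure_mono_null ?_ (hc x hx.1)
  rintro z ⟨hz, hz'⟩ hzz
  simp only [Set.mem_ofPred_eq, Classical.not_imp] at hz
  exact hz.2 ((hzz hz').trans (hcc x hx.1))

/-- A function all of whose second weak partial derivatives vanish is affine. -/
theorem exists_ae_eq_affine (hΘ : IsOpen Θ) (hconn : IsConnected Θ) {u : E d → ℝ}
    (hu : LocallyIntegrableOn u Θ) (v : Fin d → E d → ℝ) (hv : ∀ i, IsWeakPartial Θ i u (v i))
    (hvv : ∀ i j, IsWeakPartial Θ j (v i) (fun _ => 0)) :
    ∃ (a : ℝ) (b : Fin d → ℝ), u =ᵐ[volume.restrict Θ] fun x => a + ∑ i, b i * x i := by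
  have h1 : ∀ i, ∃ c : ℝ, v i =ᵐ[volume.restrict Θ] fun _ => c := fun i =>
    exists_ae_eq_const_of_isWeakPartial_zero hΘ hconn (hv i).2 (hvv i)
  choose b hb using h1
  -- The first partials are constants `b i`, so removing the linear part leaves a function with zero
  -- weak gradient.
  have h2 : ∀ i, IsWeakPartial Θ i (fun x => u x - (0 + ∑ i, b i * x i)) (fun _ => 0) := by
    intro i
    refine ((hv i).sub (isWeakPartial_affine i 0 b)).congr (EventuallyEq.refl _ _) ?_
    filter_upwards [hb i] with x hx
    rw [hx, sub_self]
  have hl : LocallyIntegrableOn (fun x => u x - (0 + ∑ i, b i * x i)) Θ :=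
    hu.sub (((contDiff_affine 0 b).continuous.locallyIntegrable).locallyIntegrableOn _)
  obtain ⟨a, ha⟩ := exists_ae_eq_const_of_isWeakPartial_zero hΘ hconn hl h2
  refine ⟨a, b, ?_⟩
  filter_upwards [ha] with x hx
  linarith

end WeakDerivatives

/-! ### Tangent coordinates agree with isometric coordinates to second order -/

section TangentCoordinates

variable {d n : ℕ} {Θ : Set (E d)} {ψ : E d → E n}

/-! ### Second derivatives of compositions -/

/-- Differentiating `G ∘ y = id` twice gives `D²G(Dy, Dy) + DG(D²y) = 0`; the first term vanishes
and `DG` is injective. -/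
theorem fderiv_fderiv_eq_zero_of_comp_eq_id {V W : Type*} [NormedAddCommGroup V] [NormedSpace ℝ V]
    [NormedAddCommGroup W] [NormedSpace ℝ W] {G : V → W} {y : W → V} {w : W}
    (hG : ContDiffAt ℝ 2 G (y w)) (hy : ContDiffAt ℝ 2 y w) (hid : ∀ᶠ v in 𝓝 w, G (y v) = v)
    (hinj : Function.Injective (fderiv ℝ G (y w))) (h2 : fderiv ℝ (fderiv ℝ G) (y w) = 0) :
    fderiv ℝ (fderiv ℝ y) w = 0 := by
  have hGd : ∀ᶠ v in 𝓝 w, DifferentiableAt ℝ G (y v) :=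
    hy.continuousAt.eventually ((hG.eventually (by simp)).mono fun _ h =>
      h.differentiableAt (by simp))
  have hyd : ∀ᶠ v in 𝓝 w, DifferentiableAt ℝ y v :=
    (hy.eventually (by simp)).mono fun _ h => h.differentiableAt (by simp)
  have h1 : (fun v => (fderiv ℝ G (y v)).comp (fderiv ℝ y v))
      =ᶠ[𝓝 w] fun _ => ContinuousLinearMap.id ℝ W := by
    filter_upwards [hGd, hyd, hid.eventually_nhds] with v hv1 hv2 hv3
    rw [← fderiv_comp v hv1 hv2]
    have : G ∘ y =ᶠ[𝓝 v] id := hv3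
    rw [this.fderiv_eq, fderiv_id]
  have hG' : HasFDerivAt (fderiv ℝ G) (0 : V →L[ℝ] V →L[ℝ] W) (y w) := by
    rw [← h2]
    exact ((hG.fderiv_right (m := 1) (by norm_num)).differentiableAt (by simp)).hasFDerivAt
  have hy' : HasFDerivAt (fderiv ℝ y) (fderiv ℝ (fderiv ℝ y) w) w :=
    ((hy.fderiv_right (m := 1) (by norm_num)).differentiableAt (by simp)).hasFDerivAt
  have hc := (hG'.comp w (hy.differentiableAt (by simp)).hasFDerivAt).clm_comp hy'
  have h3 := hc.fderiv
  have h4 : fderiv ℝ (fun v => (fderiv ℝ G (y v)).comp (fderiv ℝ y v)) w = 0 := by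
    rw [h1.fderiv_eq]
    simp
  ext v v'
  apply hinj
  have h5 := DFunLike.congr_fun (DFunLike.congr_fun (h3.symm.trans h4) v) v'
  simpa using h5

theorem fderiv_quadratic {V : Type*} [NormedAddCommGroup V] [NormedSpace ℝ V]
    {w : Fin d → V → ℝ} {v : V} (hw : ∀ i, DifferentiableAt ℝ (w i) v)
    (c₀ : ℝ) (c : Fin d → ℝ) (C : Fin d → Fin d → ℝ) :
    fderiv ℝ (fun v => c₀ + ∑ i, c i * w i v + 1 / 2 * ∑ i, ∑ j, C i j * w i v * w j v) v
      = ∑ i, c i • fderiv ℝ (w i) v + (1 / 2 : ℝ) • ∑ i, ∑ j,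
        ((C i j * w i v) • fderiv ℝ (w j) v + w j v • C i j • fderiv ℝ (w i) v) := by
  apply HasFDerivAt.fderiv
  refine HasFDerivAt.add (HasFDerivAt.const_add _ (HasFDerivAt.fun_sum fun i _ =>
    (hw i).hasFDerivAt.const_mul _)) (HasFDerivAt.const_mul (HasFDerivAt.fun_sum fun i _ =>
    HasFDerivAt.fun_sum fun j _ => ?_) _)
  exact ((hw i).hasFDerivAt.const_mul _).mul (hw j).hasFDerivAt

/-- Where the `w i` and their second derivatives vanish, only products of first derivatives survive.
`C` is not assumed symmetric, so both orders appear. -/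
theorem fderiv_fderiv_quadratic {V : Type*} [NormedAddCommGroup V] [NormedSpace ℝ V]
    {w : Fin d → V → ℝ} {v : V} (hw : ∀ i, ContDiffAt ℝ 2 (w i) v)
    (h0 : ∀ i, w i v = 0) (h2 : ∀ i, fderiv ℝ (fderiv ℝ (w i)) v = 0)
    (c₀ : ℝ) (c : Fin d → ℝ) (C : Fin d → Fin d → ℝ) (a b : V) :
    fderiv ℝ (fderiv ℝ
      (fun v => c₀ + ∑ i, c i * w i v + 1 / 2 * ∑ i, ∑ j, C i j * w i v * w j v)) v a b
      = 1 / 2 * ∑ i, ∑ j, C i j *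
        (fderiv ℝ (w i) v a * fderiv ℝ (w j) v b + fderiv ℝ (w j) v a * fderiv ℝ (w i) v b) := by
  have hd : ∀ i, HasFDerivAt (w i) (fderiv ℝ (w i) v) v := fun i =>
    ((hw i).differentiableAt (by simp)).hasFDerivAt
  have hd' : ∀ i, HasFDerivAt (fderiv ℝ (w i)) (0 : V →L[ℝ] V →L[ℝ] ℝ) v := fun i => by
    rw [← h2 i]
    exact (((hw i).fderiv_right (m := 1) (by norm_num)).differentiableAt (by simp)).hasFDerivAt
  have hev : ∀ᶠ z in 𝓝 v, ∀ i, DifferentiableAt ℝ (w i) z :=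
    eventually_all.2 fun i => ((hw i).eventually (by simp)).mono fun _ h =>
      h.differentiableAt (by simp)
  have he : fderiv ℝ
      (fun v => c₀ + ∑ i, c i * w i v + 1 / 2 * ∑ i, ∑ j, C i j * w i v * w j v) =ᶠ[𝓝 v]
      fun z => ∑ i, c i • fderiv ℝ (w i) z + (1 / 2 : ℝ) • ∑ i, ∑ j,
        ((C i j * w i z) • fderiv ℝ (w j) z + w j z • C i j • fderiv ℝ (w i) z) := by
    filter_upwards [hev] with z hz
    exact fderiv_quadratic hz c₀ c C
  have hfin := HasFDerivAt.add
    (HasFDerivAt.fun_sum (u := Finset.univ) fun i _ => (hd' i).const_smul (c i))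
    (HasFDerivAt.const_smul (HasFDerivAt.fun_sum (u := Finset.univ) fun i _ =>
      HasFDerivAt.fun_sum (u := Finset.univ) fun j _ =>
      (((hd i).const_mul (C i j)).smul (hd' j)).add ((hd j).smul ((hd' i).const_smul (C i j))))
      (1 / 2 : ℝ))
  rw [he.fderiv_eq]
  have hfin' := hfin.fderiv
  refine (DFunLike.congr_fun (DFunLike.congr_fun hfin' a) b).trans ?_
  simp only [h0, smul_zero, Finset.sum_const_zero, zero_add, smul_apply,
    sum_apply, add_apply,
    ContinuousLinearMap.smulRight_apply, smul_eq_mul]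
  congr 1
  refine Finset.sum_congr rfl fun i _ => Finset.sum_congr rfl fun j _ => ?_
  rw [show (C i j • fderiv ℝ (w i)) v b = C i j * fderiv ℝ (w i) v b from rfl]
  ring

/-! ### The second fundamental form -/

theorem IsLocallyIsometricEmbedding.contDiffAt (hψ : IsLocallyIsometricEmbedding Θ ψ)
    (hΘ : IsOpen Θ) {x : E d} (hx : x ∈ Θ) : ContDiffAt ℝ ∞ ψ x :=
  hψ.contDiffOn.contDiffAt (hΘ.mem_nhds hx)

theorem IsLocallyIsometricEmbedding.injOn (hψ : IsLocallyIsometricEmbedding Θ ψ) :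
    Set.InjOn ψ Θ :=
  Set.injOn_iff_injective.2 hψ.isEmbedding.injective

/-- The second derivative of an isometric immersion of a flat domain is normal. -/
theorem IsLocallyIsometricEmbedding.inner_fderiv_fderiv_eq_zero
    (hψ : IsLocallyIsometricEmbedding Θ ψ) (hΘ : IsOpen Θ) {x : E d} (hx : x ∈ Θ) (u v w : E d) :
    inner ℝ (fderiv ℝ (fderiv ℝ ψ) x u v) (fderiv ℝ ψ x w) = 0 := by
  have hc := hψ.contDiffAt hΘ hx
  have hd : DifferentiableAt ℝ (fderiv ℝ ψ) x :=
    (hc.fderiv_right (m := 1) (by norm_cast)).differentiableAt (by simp)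
  have hsymm : ∀ a b, fderiv ℝ (fderiv ℝ ψ) x a b = fderiv ℝ (fderiv ℝ ψ) x b a := fun a b =>
    (hc.isSymmSndFDerivAt (by rw [minSmoothness_of_isRCLikeNormedField]; norm_cast)).eq a b
  have hskew : ∀ a b c, inner ℝ (fderiv ℝ (fderiv ℝ ψ) x a b) (fderiv ℝ ψ x c)
      + inner ℝ (fderiv ℝ (fderiv ℝ ψ) x a c) (fderiv ℝ ψ x b) = 0 := by
    intro a b c
    have h1 : (fun y => inner ℝ (fderiv ℝ ψ y b) (fderiv ℝ ψ y c))
        =ᶠ[𝓝 x] fun _ => inner ℝ b c := by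
      filter_upwards [hΘ.mem_nhds hx] with y hy
      exact hψ.inner_fderiv y hy b c
    have hb : HasFDerivAt (fun y => fderiv ℝ ψ y b) ((fderiv ℝ (fderiv ℝ ψ) x).flip b) x := by
      simpa using hd.hasFDerivAt.clm_apply (hasFDerivAt_const b x)
    have hcc : HasFDerivAt (fun y => fderiv ℝ ψ y c) ((fderiv ℝ (fderiv ℝ ψ) x).flip c) x := by
      simpa using hd.hasFDerivAt.clm_apply (hasFDerivAt_const c x)
    have h2 := (hb.inner ℝ hcc).fderiv
    rw [h1.fderiv_eq, fderiv_fun_const] at h2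
    have h3 := DFunLike.congr_fun h2 a
    simp [fderivInnerCLM_apply] at h3
    rw [real_inner_comm (fderiv ℝ ψ x b)]
    linarith
  -- As in the Koszul formula: a trilinear form symmetric in its first two arguments and skew in its
  -- last two is zero.
  have h1 := hskew u v w
  have h2 := hskew w u v
  have h3 := hskew v w u
  rw [hsymm w u] at h2
  rw [hsymm w v] at h2
  rw [hsymm v u] at h3
  linarith

/-! ### Isometric coordinates in terms of tangent coordinates -/

theorem IsLocallyIsometricEmbedding.isoCoord_apply (hψ : IsLocallyIsometricEmbedding Θ ψ)
    {x : E d} (hx : x ∈ Θ) : isoCoord Θ ψ (ψ x) = x :=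
  hψ.injOn.leftInvOn_invFunOn hx

theorem isoCoord_mem {p : E n} (hp : p ∈ ψ '' Θ) : isoCoord Θ ψ p ∈ Θ :=
  Function.invFunOn_mem hp

theorem apply_isoCoord {p : E n} (hp : p ∈ ψ '' Θ) : ψ (isoCoord Θ ψ p) = p :=
  Function.invFunOn_eq hp

/-- This is where `ψ` must be a homeomorphism onto its image rather than just injective: points of
`M` near `p` have parameters near `θ(p)`, so every tangent parametrisation stays on the same sheet.
-/
theorem IsLocallyIsometricEmbedding.continuousWithinAt_isoCoord
    (hψ : IsLocallyIsometricEmbedding Θ ψ) {p : E n} (hp : p ∈ ψ '' Θ) :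
    ContinuousWithinAt (isoCoord Θ ψ) (ψ '' Θ) p := by
  rw [ContinuousWithinAt, (nhdsWithin_eq_map_subtype_coe hp), tendsto_map'_iff]
  have h1 : Function.comp (isoCoord Θ ψ) ((↑) : ψ '' Θ → E n) =
      fun q => ((⟨isoCoord Θ ψ q.1, isoCoord_mem q.2⟩ : Θ) : E d) := rfl
  rw [h1]
  have h2 : Continuous fun q : ψ '' Θ => (⟨isoCoord Θ ψ q.1, isoCoord_mem q.2⟩ : Θ) := by
    rw [hψ.isEmbedding.continuous_iff]
    have : Θ.domRestrict ψ ∘ (fun q : ψ '' Θ => (⟨isoCoord Θ ψ q.1, isoCoord_mem q.2⟩ : Θ))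
        = Subtype.val := funext fun q => apply_isoCoord q.2
    rw [this]
    exact continuous_subtype_val
  exact (continuous_subtype_val.comp h2).continuousAt (x := ⟨p, hp⟩)

/-- The differential of `ψ` as an isometry onto the tangent space. -/
noncomputable def tangentIsometry (hψ : IsLocallyIsometricEmbedding Θ ψ) {p : E n}
    (hp : p ∈ ψ '' Θ) : E d ≃ₗᵢ[ℝ] tangentSubspace Θ ψ p :=
  LinearIsometry.equivRange
    { (fderiv ℝ ψ (isoCoord Θ ψ p)).toLinearMap with
      norm_map' := fun v => by
        have := hψ.inner_fderiv _ (isoCoord_mem hp) v v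
        rw [real_inner_self_eq_norm_sq, real_inner_self_eq_norm_sq] at this
        exact (sq_eq_sq₀ (norm_nonneg _) (norm_nonneg _)).1 this }

theorem contDiffAt_tangentProj_comp (hψ : IsLocallyIsometricEmbedding Θ ψ) (hΘ : IsOpen Θ)
    (p : E n) {x : E d} (hx : x ∈ Θ) : ContDiffAt ℝ ∞ (fun y => tangentProj Θ ψ p (ψ y)) x :=
  ((tangentSubspace Θ ψ p).orthogonalProjectionOnto.contDiff.contDiffAt).comp x
    ((hψ.contDiffAt hΘ hx).sub contDiffAt_const)

theorem hasFDerivAt_tangentProj_comp (hψ : IsLocallyIsometricEmbedding Θ ψ) (hΘ : IsOpen Θ)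
    (p : E n) {x : E d} (hx : x ∈ Θ) : HasFDerivAt (fun y => tangentProj Θ ψ p (ψ y))
      ((tangentSubspace Θ ψ p).orthogonalProjectionOnto.comp (fderiv ℝ ψ x)) x :=
  ((tangentSubspace Θ ψ p).orthogonalProjectionOnto.hasFDerivAt).comp x
    (((hψ.contDiffAt hΘ hx).differentiableAt (by simp)).hasFDerivAt.sub_const p)

theorem hasFDerivAt_tangentProj_comp_self (hψ : IsLocallyIsometricEmbedding Θ ψ) (hΘ : IsOpen Θ)
    {p : E n} (hp : p ∈ ψ '' Θ) : HasFDerivAt (fun y => tangentProj Θ ψ p (ψ y))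
      ((tangentIsometry hψ hp).toContinuousLinearEquiv : E d →L[ℝ] tangentSubspace Θ ψ p)
      (isoCoord Θ ψ p) := by
  have h : ((tangentIsometry hψ hp).toContinuousLinearEquiv : E d →L[ℝ] tangentSubspace Θ ψ p) =
      (tangentSubspace Θ ψ p).orthogonalProjectionOnto.comp (fderiv ℝ ψ (isoCoord Θ ψ p)) := by
    ext1 v
    exact ((tangentSubspace Θ ψ p).orthogonalProjectionOnto_mem_subspace_eq_self
      (tangentIsometry hψ hp v)).symm
  rw [h]
  exact hasFDerivAt_tangentProj_comp hψ hΘ p (isoCoord_mem hp)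

/-- The projection is linear up to translation, and the second derivative of `ψ` is orthogonal to
the tangent space. -/
theorem fderiv_fderiv_tangentProj_comp (hψ : IsLocallyIsometricEmbedding Θ ψ) (hΘ : IsOpen Θ)
    {p : E n} (hp : p ∈ ψ '' Θ) :
    fderiv ℝ (fderiv ℝ fun y => tangentProj Θ ψ p (ψ y)) (isoCoord Θ ψ p) = 0 := by
  have hx := isoCoord_mem hp
  have he : (fderiv ℝ fun y => tangentProj Θ ψ p (ψ y)) =ᶠ[𝓝 (isoCoord Θ ψ p)]
      fun y => (tangentSubspace Θ ψ p).orthogonalProjectionOnto.comp (fderiv ℝ ψ y) := by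
    filter_upwards [hΘ.mem_nhds hx] with y hy
    exact (hasFDerivAt_tangentProj_comp hψ hΘ p hy).fderiv
  have hd : DifferentiableAt ℝ (fderiv ℝ ψ) (isoCoord Θ ψ p) :=
    ((hψ.contDiffAt hΘ hx).fderiv_right (m := 1) (by norm_cast)).differentiableAt (by simp)
  have hd2 := (hasFDerivAt_const (tangentSubspace Θ ψ p).orthogonalProjectionOnto
    (isoCoord Θ ψ p)).clm_comp hd.hasFDerivAt
  rw [he.fderiv_eq, hd2.fderiv]
  ext1 u
  ext1 v
  simp only [add_apply, ContinuousLinearMap.comp_apply, map_zero,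
    ContinuousLinearMap.compL_apply, zero_apply, add_zero]
  rw [Submodule.orthogonalProjectionOnto_eq_zero_iff, Submodule.mem_orthogonal']
  rintro _ ⟨w, rfl⟩
  exact hψ.inner_fderiv_fderiv_eq_zero hΘ hx u v w

/-- By the inverse function theorem `π_p ∘ ψ` has a local inverse `L`, and `ψ ∘ L` inverts `π_p`.
Hence `tangentParam` never takes its default value at a point of `M`. -/
theorem exists_isTangentParam (hψ : IsLocallyIsometricEmbedding Θ ψ) (hΘ : IsOpen Θ)
    {p : E n} (hp : p ∈ ψ '' Θ) : ∃ s, IsTangentParam Θ ψ p s := by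
  have hx := isoCoord_mem hp
  have hG0 : tangentProj Θ ψ p (ψ (isoCoord Θ ψ p)) = 0 := by
    rw [apply_isoCoord hp, tangentProj, sub_self, _root_.map_zero]
  have hs := (contDiffAt_tangentProj_comp hψ hΘ p hx).hasStrictFDerivAt'
    (hasFDerivAt_tangentProj_comp_self hψ hΘ hp) (by simp)
  set L := hs.localInverse with hL
  have hLc : ContinuousAt L 0 := by
    have := hs.localInverse_continuousAt
    rwa [hG0] at this
  have hL0 : L 0 = isoCoord Θ ψ p := by
    have := hs.localInverse_apply_image
    rwa [hG0] at this
  have hev : ∀ᶠ v in 𝓝 0, L v ∈ Θ :=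
    hLc.eventually (by rw [hL0]; exact hΘ.mem_nhds hx)
  refine ⟨fun v => ψ (L v), by rw [hL0, apply_isoCoord hp], ?_, ?_, ?_⟩
  · refine ContinuousAt.comp (g := ψ) ?_ hLc
    rw [hL0]
    exact (hψ.contDiffAt hΘ hx).continuousAt
  · exact hev.mono fun v hv => ⟨_, hv, rfl⟩
  · have := hs.eventually_right_inverse
    rwa [hG0] at this

theorem isTangentParam_tangentParam (hψ : IsLocallyIsometricEmbedding Θ ψ) (hΘ : IsOpen Θ)
    {p : E n} (hp : p ∈ ψ '' Θ) : IsTangentParam Θ ψ p (tangentParam Θ ψ p) := by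
  have h := exists_isTangentParam hψ hΘ hp
  rw [tangentParam, dif_pos h]
  exact h.choose_spec

section IsTangentParam

variable {p : E n} {s : tangentSubspace Θ ψ p → E n}

theorem IsTangentParam.tendsto_isoCoord (hs : IsTangentParam Θ ψ p s)
    (hψ : IsLocallyIsometricEmbedding Θ ψ) (hp : p ∈ ψ '' Θ) :
    Tendsto (fun v => isoCoord Θ ψ (s v)) (𝓝 0) (𝓝 (isoCoord Θ ψ p)) := by
  have h1 : Tendsto s (𝓝 0) (𝓝[ψ '' Θ] p) := by
    refine tendsto_nhdsWithin_iff.2 ⟨?_, hs.eventually_mem⟩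
    have := hs.continuousAt.tendsto
    rwa [hs.map_zero] at this
  exact (hψ.continuousWithinAt_isoCoord hp).tendsto.comp h1

theorem IsTangentParam.eventually_proj_isoCoord (hs : IsTangentParam Θ ψ p s) :
    ∀ᶠ v in 𝓝 0, tangentProj Θ ψ p (ψ (isoCoord Θ ψ (s v))) = v := by
  filter_upwards [hs.eventually_mem, hs.eventually_proj] with v h1 h2
  rw [apply_isoCoord h1, h2]

/-- A tangent parametrisation is only assumed continuous at the origin; smoothness follows because
`θ ∘ s` must coincide near 0 with the local inverse of `π_p ∘ ψ`. -/
theorem IsTangentParam.contDiffAt_isoCoord (hs : IsTangentParam Θ ψ p s)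
    (hψ : IsLocallyIsometricEmbedding Θ ψ) (hΘ : IsOpen Θ) (hp : p ∈ ψ '' Θ) :
    ContDiffAt ℝ 2 (fun v => isoCoord Θ ψ (s v)) 0 := by
  have hx := isoCoord_mem hp
  have hG0 : tangentProj Θ ψ p (ψ (isoCoord Θ ψ p)) = 0 := by
    rw [apply_isoCoord hp, tangentProj, sub_self, _root_.map_zero]
  have hc : ContDiffAt ℝ 2 (fun y => tangentProj Θ ψ p (ψ y)) (isoCoord Θ ψ p) :=
    (contDiffAt_tangentProj_comp hψ hΘ p hx).of_le (by norm_cast)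
  have hd := hasFDerivAt_tangentProj_comp_self hψ hΘ hp
  have hL := hc.to_localInverse hd (by simp)
  rw [hG0] at hL
  refine hL.congr_of_eventuallyEq ?_
  have h1 := (hc.hasStrictFDerivAt' hd (by simp)).eventually_left_inverse
  filter_upwards [(hs.tendsto_isoCoord hψ hp).eventually h1, hs.eventually_proj_isoCoord]
    with v hv1 hv2
  rw [hv2] at hv1
  exact hv1.symm

theorem IsTangentParam.fderiv_fderiv_isoCoord (hs : IsTangentParam Θ ψ p s)
    (hψ : IsLocallyIsometricEmbedding Θ ψ) (hΘ : IsOpen Θ) (hp : p ∈ ψ '' Θ) :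
    fderiv ℝ (fderiv ℝ fun v => isoCoord Θ ψ (s v)) 0 = 0 := by
  refine fderiv_fderiv_eq_zero_of_comp_eq_id (G := fun y => tangentProj Θ ψ p (ψ y))
    ?_ (hs.contDiffAt_isoCoord hψ hΘ hp) hs.eventually_proj_isoCoord ?_ ?_
  · rw [hs.map_zero]
    exact (contDiffAt_tangentProj_comp hψ hΘ p (isoCoord_mem hp)).of_le (by norm_cast)
  · rw [hs.map_zero, (hasFDerivAt_tangentProj_comp_self hψ hΘ hp).fderiv]
    exact (tangentIsometry hψ hp).injective
  · rw [hs.map_zero]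
    exact fderiv_fderiv_tangentProj_comp hψ hΘ hp

theorem IsTangentParam.fderiv_isoCoord (hs : IsTangentParam Θ ψ p s)
    (hψ : IsLocallyIsometricEmbedding Θ ψ) (hΘ : IsOpen Θ) (hp : p ∈ ψ '' Θ) (z : E d) :
    fderiv ℝ (fun v => isoCoord Θ ψ (s v)) 0 (tangentIsometry hψ hp z) = z := by
  have hd := hasFDerivAt_tangentProj_comp_self hψ hΘ hp
  have hd' : HasFDerivAt (fun y => tangentProj Θ ψ p (ψ y))
      ((tangentIsometry hψ hp).toContinuousLinearEquiv : E d →L[ℝ] tangentSubspace Θ ψ p)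
      (isoCoord Θ ψ (s 0)) := by
    rwa [hs.map_zero]
  have hc := hd'.comp (f := fun v => isoCoord Θ ψ (s v)) 0
    ((hs.contDiffAt_isoCoord hψ hΘ hp).differentiableAt (by simp)).hasFDerivAt
  have hid : HasFDerivAt (fun v => tangentProj Θ ψ p (ψ (isoCoord Θ ψ (s v))))
      (ContinuousLinearMap.id ℝ (tangentSubspace Θ ψ p)) 0 :=
    (hasFDerivAt_id 0).congr_of_eventuallyEq hs.eventually_proj_isoCoord
  apply (tangentIsometry hψ hp).injective
  exact DFunLike.congr_fun (hc.unique hid) (tangentIsometry hψ hp z)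

/-- The derivatives of the `i`-th isometric coordinate, centered at `p`. -/
theorem IsTangentParam.coord (hs : IsTangentParam Θ ψ p s)
    (hψ : IsLocallyIsometricEmbedding Θ ψ) (hΘ : IsOpen Θ) (hp : p ∈ ψ '' Θ) (i : Fin d) :
    ContDiffAt ℝ 2 (fun v => isoCoord Θ ψ (s v) i - isoCoord Θ ψ p i) 0 ∧
    (∀ z, fderiv ℝ (fun v => isoCoord Θ ψ (s v) i - isoCoord Θ ψ p i) 0
      (tangentIsometry hψ hp z) = z i) ∧
    fderiv ℝ (fderiv ℝ fun v => isoCoord Θ ψ (s v) i - isoCoord Θ ψ p i) 0 = 0 := by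
  have hc := hs.contDiffAt_isoCoord hψ hΘ hp
  let π : E d →L[ℝ] ℝ := EuclideanSpace.proj i
  have hD : ∀ v, DifferentiableAt ℝ (fun v => isoCoord Θ ψ (s v)) v →
      fderiv ℝ (fun v => isoCoord Θ ψ (s v) i - isoCoord Θ ψ p i) v
        = π.comp (fderiv ℝ (fun v => isoCoord Θ ψ (s v)) v) := fun v hv =>
    ((π.hasFDerivAt.comp v hv.hasFDerivAt).sub_const _).fderiv
  refine ⟨(π.contDiff.contDiffAt.comp 0 hc).sub contDiffAt_const, fun z => ?_, ?_⟩
  · rw [hD 0 (hc.differentiableAt (by simp)), ContinuousLinearMap.comp_apply,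
      hs.fderiv_isoCoord hψ hΘ hp]
    rfl
  · have he : (fderiv ℝ fun v => isoCoord Θ ψ (s v) i - isoCoord Θ ψ p i) =ᶠ[𝓝 0]
        fun v => π.comp (fderiv ℝ (fun v => isoCoord Θ ψ (s v)) v) := by
      filter_upwards [hc.eventually (by simp)] with v hv
      exact hD v (hv.differentiableAt (by simp))
    have hd : DifferentiableAt ℝ (fderiv ℝ fun v => isoCoord Θ ψ (s v)) 0 :=
      (hc.fderiv_right (m := 1) (by norm_num)).differentiableAt (by simp)
    have hd2 := (hasFDerivAt_const π (0 : tangentSubspace Θ ψ p)).clm_comp hd.hasFDerivAt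
    rw [he.fderiv_eq, hd2.fderiv, hs.fderiv_fderiv_isoCoord hψ hΘ hp]
    simp

end IsTangentParam

/-! ### The weak differential and the weak Hessian -/

theorem weakTanDeriv_apply (hψ : IsLocallyIsometricEmbedding Θ ψ) (hΘ : IsOpen Θ)
    {p : E n} (hp : p ∈ ψ '' Θ) (f : E n → ℝ) (z : E d) :
    weakTanDeriv Θ ψ f p (tangentIsometry hψ hp z)
      = ∑ i, weakPartial Θ i (f ∘ ψ) (isoCoord Θ ψ p) * z i := by
  have hs := isTangentParam_tangentParam hψ hΘ hp
  have hc := hs.coord hψ hΘ hp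
  have := fderiv_quadratic (fun i => (hc i).1.differentiableAt (by simp)) (f p)
    (fun i => weakPartial Θ i (f ∘ ψ) (isoCoord Θ ψ p))
    (fun i j => weakPartial Θ j (weakPartial Θ i (f ∘ ψ)) (isoCoord Θ ψ p))
  refine (DFunLike.congr_fun this _).trans ?_
  simp [hs.map_zero, (hc _).2.1]

/-- The jet is quadratic in the centred isometric coordinates, which have no second-order part in
tangent coordinates, so its linear terms contribute nothing. -/
theorem weakTanHess_apply (hψ : IsLocallyIsometricEmbedding Θ ψ) (hΘ : IsOpen Θ)
    {p : E n} (hp : p ∈ ψ '' Θ) (f : E n → ℝ) (z z' : E d) :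
    weakTanHess Θ ψ f p (tangentIsometry hψ hp z) (tangentIsometry hψ hp z')
      = 1 / 2 * ∑ i, ∑ j, weakPartial Θ j (weakPartial Θ i (f ∘ ψ)) (isoCoord Θ ψ p)
        * (z i * z' j + z j * z' i) := by
  have hs := isTangentParam_tangentParam hψ hΘ hp
  have hc := hs.coord hψ hΘ hp
  have := fderiv_fderiv_quadratic (fun i => (hc i).1) (fun i => by rw [hs.map_zero, sub_self])
    (fun i => (hc i).2.2) (f p)
    (fun i => weakPartial Θ i (f ∘ ψ) (isoCoord Θ ψ p))
    (fun i j => weakPartial Θ j (weakPartial Θ i (f ∘ ψ)) (isoCoord Θ ψ p))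
    (tangentIsometry hψ hp z) (tangentIsometry hψ hp z')
  refine Eq.trans this ?_
  simp only [(hc _).2.1]

theorem weakTanHess_stdVec (hψ : IsLocallyIsometricEmbedding Θ ψ) (hΘ : IsOpen Θ)
    {p : E n} (hp : p ∈ ψ '' Θ) (f : E n → ℝ) (i j : Fin d) :
    weakTanHess Θ ψ f p (tangentIsometry hψ hp (stdVec i)) (tangentIsometry hψ hp (stdVec j))
      = 1 / 2 * (weakPartial Θ j (weakPartial Θ i (f ∘ ψ)) (isoCoord Θ ψ p)
        + weakPartial Θ i (weakPartial Θ j (f ∘ ψ)) (isoCoord Θ ψ p)) := by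
  rw [weakTanHess_apply hψ hΘ hp]
  simp [stdVec, mul_add, Finset.sum_add_distrib]

theorem frobSq_zero {V : Type*} [NormedAddCommGroup V] [InnerProductSpace ℝ V]
    [FiniteDimensional ℝ V] : frobSq (0 : V →L[ℝ] V →L[ℝ] ℝ) = 0 := by
  simp [frobSq]

/-- Cauchy–Schwarz in each argument. This controls entries in the basis coming from `ψ` without
proving that the Frobenius norm is independent of the basis. -/
theorem sq_apply_le_frobSq {V : Type*} [NormedAddCommGroup V] [InnerProductSpace ℝ V]
    [FiniteDimensional ℝ V] (B : V →L[ℝ] V →L[ℝ] ℝ) {v w : V} (hv : ‖v‖ = 1) (hw : ‖w‖ = 1) :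
    (B v w) ^ 2 ≤ frobSq B := by
  set e := stdOrthonormalBasis ℝ V with he
  have hBv : ∀ a, (B (e a) w) ^ 2 ≤ ∑ b, (B (e a) (e b)) ^ 2 := by
    intro a
    have h1 : B (e a) w = ∑ b, inner ℝ (e b) w * B (e a) (e b) := by
      conv_lhs => rw [← e.sum_repr' w]
      simp
    rw [h1]
    refine (Finset.sum_mul_sq_le_sq_mul_sq _ _ _).trans ?_
    rw [show ∑ b, (inner ℝ (e b) w) ^ 2 = 1 by
      have := e.sum_sq_norm_inner_right w
      simpa [hw] using this, one_mul]
  have h2 : B v w = ∑ a, inner ℝ (e a) v * B (e a) w := by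
    conv_lhs => rw [← e.sum_repr' v]
    simp
  rw [h2]
  refine (Finset.sum_mul_sq_le_sq_mul_sq _ _ _).trans ?_
  rw [show ∑ b, (inner ℝ (e b) v) ^ 2 = 1 by
      have := e.sum_sq_norm_inner_right v
      simpa [hv] using this, one_mul]
  exact Finset.sum_le_sum fun a _ => hBv a

end TangentCoordinates

/-! ### Riemannian volume as Lebesgue measure on `Θ`, and its null sets -/

section Measures

variable {d n : ℕ} {Θ : Set (E d)} {ψ : E d → E n}

theorem gramMatrix_eq_one (hψ : IsLocallyIsometricEmbedding Θ ψ) {x : E d} (hx : x ∈ Θ) :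
    gramMatrix ψ x = 1 := by
  ext i j
  rw [gramMatrix, Matrix.of_apply, hψ.inner_fderiv x hx, stdVec, stdVec, Matrix.one_apply]
  simp [EuclideanSpace.inner_single_left]

theorem measurableEmbedding_domRestrict (hψ : IsLocallyIsometricEmbedding Θ ψ) (hΘ : IsOpen Θ) :
    MeasurableEmbedding (Θ.domRestrict ψ) :=
  hψ.contDiffOn.continuousOn.measurableEmbedding hΘ.measurableSet hψ.injOn

/-- The volume density is 1 on `Θ`. Passing to the subtype replaces `ψ`, which is uncontrolled off
`Θ`, by a measurable embedding. -/
theorem riemVolume_eq_map (hψ : IsLocallyIsometricEmbedding Θ ψ) (hΘ : IsOpen Θ) :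
    riemVolume Θ ψ
      = ((volume : Measure (E d)).comap ((↑) : Θ → E d)).map (Θ.domRestrict ψ) := by
  have h1 : (volume.restrict Θ).withDensity (fun x => ENNReal.ofReal √(gramMatrix ψ x).det)
      = (volume.restrict Θ : Measure (E d)) := by
    refine (withDensity_congr_ae ?_).trans withDensity_one
    filter_upwards [ae_restrict_mem hΘ.measurableSet] with x hx
    simp [gramMatrix_eq_one hψ hx]
  have hm : AEMeasurable ψ (volume.restrict Θ) :=
    hψ.contDiffOn.continuousOn.aemeasurable hΘ.measurableSet
  rw [riemVolume, h1]
  rw [← map_comap_subtype_coe hΘ.measurableSet] at hm ⊢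
  exact AEMeasurable.map_map_of_aemeasurable hm measurable_subtype_coe.aemeasurable

theorem ae_riemVolume_iff (hψ : IsLocallyIsometricEmbedding Θ ψ) (hΘ : IsOpen Θ)
    {P : E n → Prop} :
    (∀ᵐ p ∂riemVolume Θ ψ, P p) ↔ ∀ᵐ x ∂volume.restrict Θ, P (ψ x) := by
  rw [riemVolume_eq_map hψ hΘ, (measurableEmbedding_domRestrict hψ hΘ).ae_map_iff,
    ← map_comap_subtype_coe hΘ.measurableSet,
    (MeasurableEmbedding.subtype_coe hΘ.measurableSet).ae_map_iff]
  rfl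

theorem aemeasurable_riemVolume_iff (hψ : IsLocallyIsometricEmbedding Θ ψ) (hΘ : IsOpen Θ)
    {g : E n → ℝ} :
    AEMeasurable g (riemVolume Θ ψ) ↔ AEMeasurable (g ∘ ψ) (volume.restrict Θ) := by
  rw [riemVolume_eq_map hψ hΘ, (measurableEmbedding_domRestrict hψ hΘ).aemeasurable_map_iff,
    ← map_comap_subtype_coe hΘ.measurableSet,
    (MeasurableEmbedding.subtype_coe hΘ.measurableSet).aemeasurable_map_iff]
  rfl

theorem ae_mem_image (hψ : IsLocallyIsometricEmbedding Θ ψ) (hΘ : IsOpen Θ) :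
    ∀ᵐ p ∂riemVolume Θ ψ, p ∈ ψ '' Θ := by
  rw [ae_riemVolume_iff hψ hΘ]
  filter_upwards [ae_restrict_mem hΘ.measurableSet] with x hx
  exact ⟨x, hx, rfl⟩

theorem riemVolume_absolutelyContinuous_withDensity (hψ : IsLocallyIsometricEmbedding Θ ψ)
    (hΘ : IsOpen Θ) {ρ : E n → ℝ} (hρ : Measurable ρ) (hpos : ∀ p ∈ ψ '' Θ, 0 < ρ p) :
    riemVolume Θ ψ ≪ (riemVolume Θ ψ).withDensity fun p => ENNReal.ofReal (ρ p) := by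
  refine withDensity_absolutelyContinuous' hρ.ennreal_ofReal.aemeasurable ?_
  filter_upwards [ae_mem_image hψ hΘ] with p hp
  simpa using hpos p hp

variable {ν : Measure (E n)}

theorem ae_iff_of_equivalent (hψ : IsLocallyIsometricEmbedding Θ ψ) (hΘ : IsOpen Θ)
    (h1 : ν ≪ riemVolume Θ ψ) (h2 : riemVolume Θ ψ ≪ ν) {P : E n → Prop} :
    (∀ᵐ p ∂ν, P p) ↔ ∀ᵐ x ∂volume.restrict Θ, P (ψ x) := by
  rw [← ae_riemVolume_iff hψ hΘ]
  exact ⟨fun h => h2.ae_le h, fun h => h1.ae_le h⟩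

theorem aemeasurable_isoCoord (hψ : IsLocallyIsometricEmbedding Θ ψ) (hΘ : IsOpen Θ)
    (h1 : ν ≪ riemVolume Θ ψ) {g : E d → ℝ} (hg : AEMeasurable g (volume.restrict Θ)) :
    AEMeasurable (fun p => g (isoCoord Θ ψ p)) ν := by
  refine AEMeasurable.mono_ac ((aemeasurable_riemVolume_iff hψ hΘ).2 (hg.congr ?_)) h1
  filter_upwards [ae_restrict_mem hΘ.measurableSet] with x hx
  rw [Function.comp_apply, hψ.isoCoord_apply hx]

end Measures

/-! ### Affine functions and the null space of the Hessian form -/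

section NullSpace

variable {d n : ℕ} {Θ : Set (E d)} {ψ : E d → E n} {ν : Measure (E n)} {f : E n → ℝ}

theorem comp_ae_eq_affine_iff (hψ : IsLocallyIsometricEmbedding Θ ψ) (hΘ : IsOpen Θ)
    (h1 : ν ≪ riemVolume Θ ψ) (h2 : riemVolume Θ ψ ≪ ν) {a : ℝ} {b : Fin d → ℝ} :
    (f =ᵐ[ν] fun p => a + ∑ i, b i * isoCoord Θ ψ p i) ↔
      f ∘ ψ =ᵐ[volume.restrict Θ] fun x => a + ∑ i, b i * x i := by
  rw [EventuallyEq, ae_iff_of_equivalent hψ hΘ h1 h2]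
  have hm : ∀ᵐ x ∂volume.restrict Θ, x ∈ Θ := ae_restrict_mem hΘ.measurableSet
  refine ⟨fun h => ?_, fun h => ?_⟩ <;> filter_upwards [h, hm] with x hx hxΘ
  · rwa [hψ.isoCoord_apply hxΘ] at hx
  · rwa [hψ.isoCoord_apply hxΘ]

section Affine

variable {a : ℝ} {b : Fin d → ℝ} {u : E d → ℝ}

theorem isWeakPartial_of_ae_eq_affine (h : u =ᵐ[volume.restrict Θ] fun x => a + ∑ i, b i * x i)
    (i : Fin d) : IsWeakPartial Θ i u (fun _ => b i) :=
  (isWeakPartial_affine i a b).congr h.symm (EventuallyEq.refl _ _)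

theorem isWeakPartial_weakPartial_of_ae_eq_affine (hΘ : IsOpen Θ)
    (h : u =ᵐ[volume.restrict Θ] fun x => a + ∑ i, b i * x i) (i j : Fin d) :
    IsWeakPartial Θ j (weakPartial Θ i u) (fun _ => 0) :=
  (isWeakPartial_const j (b i)).congr
    ((isWeakPartial_of_ae_eq_affine h i).weakPartial_ae_eq hΘ).symm (EventuallyEq.refl _ _)

theorem weakTanHess_ae_eq_zero (hψ : IsLocallyIsometricEmbedding Θ ψ) (hΘ : IsOpen Θ)
    (h1 : ν ≪ riemVolume Θ ψ)
    (h : f ∘ ψ =ᵐ[volume.restrict Θ] fun x => a + ∑ i, b i * x i) :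
    ∀ᵐ p ∂ν, weakTanHess Θ ψ f p = 0 := by
  refine h1.ae_le ((ae_riemVolume_iff hψ hΘ).2 ?_)
  have hz : ∀ᵐ x ∂volume.restrict Θ, ∀ i j,
      weakPartial Θ j (weakPartial Θ i (f ∘ ψ)) x = 0 :=
    ae_all_iff.2 fun i => ae_all_iff.2 fun j =>
      (isWeakPartial_weakPartial_of_ae_eq_affine hΘ h i j).weakPartial_ae_eq hΘ
  filter_upwards [hz, ae_restrict_mem hΘ.measurableSet] with x hx hxΘ
  have hp : ψ x ∈ ψ '' Θ := ⟨x, hxΘ, rfl⟩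
  ext1 v
  ext1 w
  obtain ⟨v, rfl⟩ := (tangentIsometry hψ hp).surjective v
  obtain ⟨w, rfl⟩ := (tangentIsometry hψ hp).surjective w
  rw [weakTanHess_apply hψ hΘ hp, hψ.isoCoord_apply hxΘ]
  simp [hx]

theorem norm_weakTanDeriv_ae_le (hψ : IsLocallyIsometricEmbedding Θ ψ) (hΘ : IsOpen Θ)
    (h1 : ν ≪ riemVolume Θ ψ)
    (h : f ∘ ψ =ᵐ[volume.restrict Θ] fun x => a + ∑ i, b i * x i) :
    ∀ᵐ p ∂ν, ‖weakTanDeriv Θ ψ f p‖ ≤ ∑ i, |b i| := by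
  refine h1.ae_le ((ae_riemVolume_iff hψ hΘ).2 ?_)
  have hz : ∀ᵐ x ∂volume.restrict Θ, ∀ i, weakPartial Θ i (f ∘ ψ) x = b i :=
    ae_all_iff.2 fun i => (isWeakPartial_of_ae_eq_affine h i).weakPartial_ae_eq hΘ
  filter_upwards [hz, ae_restrict_mem hΘ.measurableSet] with x hx hxΘ
  have hp : ψ x ∈ ψ '' Θ := ⟨x, hxΘ, rfl⟩
  refine ContinuousLinearMap.opNorm_le_bound _ (Finset.sum_nonneg fun i _ => abs_nonneg _) ?_
  intro v
  obtain ⟨v, rfl⟩ := (tangentIsometry hψ hp).surjective v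
  rw [weakTanDeriv_apply hψ hΘ hp, hψ.isoCoord_apply hxΘ, LinearIsometryEquiv.norm_map,
    Finset.sum_mul]
  refine (norm_sum_le _ _).trans (Finset.sum_le_sum fun i _ => ?_)
  rw [norm_mul, hx, Real.norm_eq_abs]
  exact mul_le_mul_of_nonneg_left (PiLp.norm_apply_le v i) (abs_nonneg _)

theorem lintegral_frobSq_weakTanHess_eq_zero (hψ : IsLocallyIsometricEmbedding Θ ψ)
    (hΘ : IsOpen Θ) (h1 : ν ≪ riemVolume Θ ψ)
    (h : f ∘ ψ =ᵐ[volume.restrict Θ] fun x => a + ∑ i, b i * x i) :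
    ∫⁻ p, ENNReal.ofReal (frobSq (weakTanHess Θ ψ f p)) ∂ν = 0 := by
  rw [← lintegral_zero (μ := ν)]
  refine lintegral_congr_ae ?_
  filter_upwards [weakTanHess_ae_eq_zero hψ hΘ h1 h] with p hp
  rw [hp, frobSq_zero, ENNReal.ofReal_zero]

theorem mem_W22_of_ae_eq_affine [IsFiniteMeasure ν] (hψ : IsLocallyIsometricEmbedding Θ ψ)
    (hΘ : IsOpen Θ) (h1 : ν ≪ riemVolume Θ ψ) {f : Lp ℝ 2 ν}
    (h : f ∘ ψ =ᵐ[volume.restrict Θ] fun x => a + ∑ i, b i * x i) : f ∈ W22 Θ ψ ν := by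
  refine ⟨fun i => ⟨_, isWeakPartial_of_ae_eq_affine h i⟩,
    fun i j => ⟨_, isWeakPartial_weakPartial_of_ae_eq_affine hΘ h i j⟩, ?_, ?_⟩
  · refine lt_of_le_of_lt (lintegral_mono_ae
      (g := fun _ => ENNReal.ofReal ((∑ i, |b i|) ^ 2)) ?_) ?_
    · filter_upwards [norm_weakTanDeriv_ae_le hψ hΘ h1 h] with p hp
      gcongr
    · rw [lintegral_const]
      exact ENNReal.mul_lt_top ENNReal.ofReal_lt_top (measure_lt_top _ _)
  · rw [lintegral_frobSq_weakTanHess_eq_zero hψ hΘ h1 h]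
    exact ENNReal.zero_lt_top

end Affine

/-- If the Hessian form vanishes, so do all second weak partial derivatives. -/
theorem weakPartial_weakPartial_ae_eq_zero (hψ : IsLocallyIsometricEmbedding Θ ψ)
    (hΘ : IsOpen Θ) {μ : Measure (E n)} (h1 : μ ≪ riemVolume Θ ψ) (h2 : riemVolume Θ ψ ≪ μ)
    (hi : ∀ i, HasWeakPartial Θ i (f ∘ ψ))
    (hij : ∀ i j, HasWeakPartial Θ j (weakPartial Θ i (f ∘ ψ)))
    (hf : hessForm Θ ψ μ f = 0) (i j : Fin d) :
    weakPartial Θ j (weakPartial Θ i (f ∘ ψ)) =ᵐ[volume.restrict Θ] fun _ => 0 := by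
  set H : E d → ℝ := fun x => 1 / 2 * (weakPartial Θ j (weakPartial Θ i (f ∘ ψ)) x
    + weakPartial Θ i (weakPartial Θ j (f ∘ ψ)) x) with hH
  have hHm : AEMeasurable H (volume.restrict Θ) :=
    (((hij i j).isWeakPartial.2.aestronglyMeasurable.aemeasurable).add
      ((hij j i).isWeakPartial.2.aestronglyMeasurable.aemeasurable)).const_mul _
  -- A vanishing integral forces a measurable integrand to vanish almost everywhere. Measurability
  -- is clear for the single entry `H`, so the argument goes through this lower bound and not
  -- through the Frobenius norm itself.
  have hle : ∫⁻ p, ENNReal.ofReal (H (isoCoord Θ ψ p) ^ 2) ∂μ ≤ hessForm Θ ψ μ f := by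
    refine lintegral_mono_ae ?_
    filter_upwards [h1.ae_le (ae_mem_image hψ hΘ)] with p hp
    refine ENNReal.ofReal_le_ofReal ?_
    simp only [hH]
    rw [← weakTanHess_stdVec hψ hΘ hp]
    refine sq_apply_le_frobSq _ ?_ ?_ <;> rw [LinearIsometryEquiv.norm_map] <;> simp [stdVec]
  rw [hf, nonpos_iff_eq_zero, lintegral_eq_zero_iff'
    ((aemeasurable_isoCoord hψ hΘ h1 hHm).pow_const 2).ennreal_ofReal] at hle
  have h0 := (ae_iff_of_equivalent hψ hΘ h1 h2).1 hle
  have hsymm := IsWeakPartial.second_symm hΘ (hi i).isWeakPartial (hi j).isWeakPartial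
    (hij i j).isWeakPartial (hij j i).isWeakPartial
  filter_upwards [h0, hsymm, ae_restrict_mem hΘ.measurableSet] with x hx hs hxΘ
  have h3 : H x ^ 2 ≤ 0 := by
    rw [hψ.isoCoord_apply hxΘ] at hx
    simpa using hx
  have h4 : H x = 0 := by
    have := sq_nonneg (H x)
    exact pow_eq_zero_iff two_ne_zero |>.1 (le_antisymm h3 this)
  simp only [hH] at h4
  linarith

theorem exists_comp_ae_eq_affine (hψ : IsLocallyIsometricEmbedding Θ ψ) (hΘ : IsOpen Θ)
    (hconn : IsConnected Θ) {μ : Measure (E n)} (h1 : μ ≪ riemVolume Θ ψ)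
    (h2 : riemVolume Θ ψ ≪ μ) (hi : ∀ i, HasWeakPartial Θ i (f ∘ ψ))
    (hij : ∀ i j, HasWeakPartial Θ j (weakPartial Θ i (f ∘ ψ)))
    (hf : hessForm Θ ψ μ f = 0) :
    ∃ (a : ℝ) (b : Fin d → ℝ), f ∘ ψ =ᵐ[volume.restrict Θ] fun x => a + ∑ i, b i * x i := by
  -- For `d = 0` there is no weak partial from which to read off local integrability, but the domain
  -- is a single point.
  rcases isEmpty_or_nonempty (Fin d) with _ | ⟨⟨k⟩⟩
  · refine ⟨f (ψ 0), 0, Eventually.of_forall fun x => ?_⟩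
    rw [Subsingleton.elim x 0]
    simp
  exact exists_ae_eq_affine hΘ hconn (hi k).isWeakPartial.1 (fun i => weakPartial Θ i (f ∘ ψ))
    (fun i => (hi i).isWeakPartial) fun i j => (hij i j).isWeakPartial.congr
      (EventuallyEq.refl _ _) (weakPartial_weakPartial_ae_eq_zero hψ hΘ h1 h2 hi hij hf i j)

theorem isFiniteMeasure_of_lintegral_isoCoord
    (h : ∫⁻ p, ENNReal.ofReal (1 + ‖isoCoord Θ ψ p‖ ^ 2) ∂ν < ⊤) : IsFiniteMeasure ν := by
  refine ⟨lt_of_le_of_lt ?_ h⟩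
  rw [← lintegral_one]
  refine lintegral_mono fun p => ?_
  rw [← ENNReal.ofReal_one]
  exact ENNReal.ofReal_le_ofReal (le_add_of_nonneg_right (sq_nonneg _))

theorem memLp_isoCoord (hψ : IsLocallyIsometricEmbedding Θ ψ) (hΘ : IsOpen Θ)
    (h1 : ν ≪ riemVolume Θ ψ) (h : ∫⁻ p, ENNReal.ofReal (1 + ‖isoCoord Θ ψ p‖ ^ 2) ∂ν < ⊤)
    (i : Fin d) : MemLp (fun p => isoCoord Θ ψ p i) 2 ν := by
  have hm : AEMeasurable (fun p => isoCoord Θ ψ p i) ν :=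
    aemeasurable_isoCoord hψ hΘ h1 (g := fun x => x i)
      (Continuous.aemeasurable (by fun_prop))
  rw [memLp_two_iff_integrable_sq hm.aestronglyMeasurable]
  refine ⟨(hm.pow_const 2).aestronglyMeasurable, ?_⟩
  rw [hasFiniteIntegral_iff_ofReal (Eventually.of_forall fun p => sq_nonneg _)]
  refine lt_of_le_of_lt (lintegral_mono fun p => ENNReal.ofReal_le_ofReal ?_) h
  have h2 := PiLp.norm_apply_le (isoCoord Θ ψ p) i
  rw [Real.norm_eq_abs] at h2
  have h3 := pow_le_pow_left₀ (abs_nonneg _) h2 2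
  rw [sq_abs] at h3
  linarith

/-- Continuity upgrades almost everywhere equality to equality on the open set; differentiating at
one point kills each `b i`, and evaluating there kills `a`. -/
theorem affine_ae_eq_zero (hΘ : IsOpen Θ) (hne : Θ.Nonempty) {a : ℝ} {b : Fin d → ℝ}
    (h : (fun x : E d => a + ∑ i, b i * x i) =ᵐ[volume.restrict Θ] fun _ => 0) :
    a = 0 ∧ ∀ i, b i = 0 := by
  have heq := Measure.eqOn_open_of_ae_eq h hΘ (contDiff_affine a b).continuous.continuousOn
    continuousOn_const
  obtain ⟨x, hx⟩ := hne
  have hb : ∀ i, b i = 0 := by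
    intro i
    have he : (fun x : E d => a + ∑ i, b i * x i) =ᶠ[𝓝 x] fun _ => 0 :=
      heq.eventuallyEq_of_mem (hΘ.mem_nhds hx)
    rw [← fderiv_affine a b x i, he.fderiv_eq]
    simp
  refine ⟨?_, hb⟩
  simpa [hb] using heq hx

end NullSpace

end HessianForm

theorem theorem1 {d n : ℕ} (Θ : Set (HessianForm.E d)) (hΘ_open : IsOpen Θ)
    (hΘ_conn : IsConnected Θ)
    (ψ : HessianForm.E d → HessianForm.E n)
    (hψ : HessianForm.IsLocallyIsometricEmbedding Θ ψ)
    -- the sampling measure: a probability measure on `M = ψ(Θ)` with positive density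
    (ρ : HessianForm.E n → ℝ) (hρ_meas : Measurable ρ) (hρ_pos : ∀ p ∈ ψ '' Θ, 0 < ρ p)
    (μ : Measure (HessianForm.E n)) [IsProbabilityMeasure μ]
    (hμ : μ = (HessianForm.riemVolume Θ ψ).withDensity fun p => ENNReal.ofReal (ρ p))
    -- square integrability in `W^{2,2}(M)` refers to the Riemannian volume, or to `μ`
    (ν : Measure (HessianForm.E n)) (hν : ν = HessianForm.riemVolume Θ ψ ∨ ν = μ) :
    -- a function in `W^{2,2}(M)` is in the null space iff it is affine in the coordinates `θ^i`
    (∀ f ∈ HessianForm.W22 Θ ψ ν, HessianForm.hessForm Θ ψ μ f = 0 ↔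
      ∃ (a : ℝ) (b : Fin d → ℝ),
        f =ᵐ[ν] fun p => a + ∑ i, b i * HessianForm.isoCoord Θ ψ p i) ∧
    -- if constants and coordinates are square integrable, they are a basis of the null space
    (∫⁻ p, ENNReal.ofReal (1 + ‖HessianForm.isoCoord Θ ψ p‖ ^ 2) ∂ν < ⊤ →
      ∃ (N : Submodule ℝ (Lp ℝ 2 ν)) (one : Lp ℝ 2 ν) (θ : Fin d → Lp ℝ 2 ν),
        (N : Set (Lp ℝ 2 ν)) = HessianForm.nullSpace Θ ψ ν μ ∧
        (one =ᵐ[ν] fun _ => (1 : ℝ)) ∧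
        (∀ i, θ i =ᵐ[ν] fun p => HessianForm.isoCoord Θ ψ p i) ∧
        N = Submodule.span ℝ (insert one (Set.range θ)) ∧
        Module.finrank ℝ N = d + 1) := by
  have hac : μ ≪ HessianForm.riemVolume Θ ψ := hμ ▸ withDensity_absolutelyContinuous _ _
  have hac' : HessianForm.riemVolume Θ ψ ≪ μ := hμ ▸
    HessianForm.riemVolume_absolutelyContinuous_withDensity hψ hΘ_open hρ_meas hρ_pos
  have hνac : ν ≪ HessianForm.riemVolume Θ ψ := by
    rcases hν with rfl | rfl
    exacts [Measure.AbsolutelyContinuous.refl _, hac]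
  have hνac' : HessianForm.riemVolume Θ ψ ≪ ν := by
    rcases hν with rfl | rfl
    exacts [Measure.AbsolutelyContinuous.refl _, hac']
  have hnull : ∀ f ∈ HessianForm.W22 Θ ψ ν, HessianForm.hessForm Θ ψ μ f = 0 ↔
      ∃ (a : ℝ) (b : Fin d → ℝ),
        f =ᵐ[ν] fun p => a + ∑ i, b i * HessianForm.isoCoord Θ ψ p i := by
    intro f hf
    simp only [HessianForm.comp_ae_eq_affine_iff hψ hΘ_open hνac hνac']
    refine ⟨fun h => HessianForm.exists_comp_ae_eq_affine hψ hΘ_open hΘ_conn hac hac'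
      hf.1 hf.2.1 h, ?_⟩
    rintro ⟨a, b, h⟩
    exact HessianForm.lintegral_frobSq_weakTanHess_eq_zero hψ hΘ_open hac h
  refine ⟨hnull, fun hint => ?_⟩
  have : IsFiniteMeasure ν := HessianForm.isFiniteMeasure_of_lintegral_isoCoord hint
  set one : Lp ℝ 2 ν := (memLp_const (1 : ℝ)).toLp _ with hone
  set θ : Fin d → Lp ℝ 2 ν := fun i =>
    (HessianForm.memLp_isoCoord hψ hΘ_open hνac hint i).toLp _ with hθ
  have hone' : one =ᵐ[ν] fun _ => (1 : ℝ) := MemLp.coeFn_toLp _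
  have hθ' : ∀ i, θ i =ᵐ[ν] fun p => HessianForm.isoCoord Θ ψ p i := fun i => MemLp.coeFn_toLp _
  have hcomb : ∀ (a : ℝ) (b : Fin d → ℝ), (a • one + ∑ i, b i • θ i : Lp ℝ 2 ν)
      =ᵐ[ν] fun p => a + ∑ i, b i * HessianForm.isoCoord Θ ψ p i := by
    intro a b
    filter_upwards [Lp.coeFn_add (a • one) (∑ i, b i • θ i), Lp.coeFn_smul a one,
      Lp.coeFn_fun_finsetSum Finset.univ fun i => b i • θ i,
      ae_all_iff.2 fun i => Lp.coeFn_smul (b i) (θ i), hone', ae_all_iff.2 hθ']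
      with p h1 h2 h3 h4 h5 h6
    rw [h1, Pi.add_apply, h2, h3, Pi.smul_apply, h5, smul_eq_mul, mul_one]
    congr 1
    refine Finset.sum_congr rfl fun i _ => ?_
    rw [h4 i, Pi.smul_apply, h6 i, smul_eq_mul]
  refine ⟨Submodule.span ℝ (insert one (Set.range θ)), one, θ, ?_, hone', hθ', rfl, ?_⟩
  · ext f
    have hspan : f ∈ Submodule.span ℝ (insert one (Set.range θ)) ↔
        ∃ (a : ℝ) (b : Fin d → ℝ),
          f =ᵐ[ν] fun p => a + ∑ i, b i * HessianForm.isoCoord Θ ψ p i := by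
      simp only [Submodule.mem_span_insert, Submodule.mem_span_range_iff_exists_fun]
      constructor
      · rintro ⟨a, _, ⟨b, rfl⟩, rfl⟩
        exact ⟨a, b, hcomb a b⟩
      · rintro ⟨a, b, h⟩
        exact ⟨a, _, ⟨b, rfl⟩, Lp.ext (h.trans (hcomb a b).symm)⟩
    rw [SetLike.mem_coe, hspan]
    constructor
    · intro h
      have hW : f ∈ HessianForm.W22 Θ ψ ν := by
        obtain ⟨a, b, h⟩ := h
        exact HessianForm.mem_W22_of_ae_eq_affine hψ hΘ_open hνac
          ((HessianForm.comp_ae_eq_affine_iff hψ hΘ_open hνac hνac').1 h)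
      exact ⟨hW, (hnull f hW).2 h⟩
    · exact fun h => (hnull f h.1).1 h.2
  · have hli : LinearIndependent ℝ (Fin.cons one θ : Fin (d + 1) → Lp ℝ 2 ν) := by
      rw [Fintype.linearIndependent_iff]
      intro g hg
      rw [Fin.sum_univ_succ] at hg
      simp only [Fin.cons_zero, Fin.cons_succ] at hg
      -- A linear relation among the classes is an affine function of the coordinates that vanishes
      -- almost everywhere; pulled back to `Θ`, its coefficients must be zero.
      have h0 : (fun _ => (0 : ℝ)) =ᵐ[ν] fun p =>
          g 0 + ∑ i : Fin d, g i.succ * HessianForm.isoCoord Θ ψ p i := by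
        have := hcomb (g 0) fun i => g i.succ
        rw [hg] at this
        exact (Lp.coeFn_zero ℝ 2 ν).symm.trans this
      rw [HessianForm.comp_ae_eq_affine_iff hψ hΘ_open hνac hνac' (b := fun i => g i.succ)] at h0
      have := HessianForm.affine_ae_eq_zero hΘ_open hΘ_conn.nonempty h0.symm
      intro i
      refine Fin.cases this.1 this.2 i
    have := finrank_span_eq_card hli
    rwa [Fin.range_cons, Fintype.card_fin] at this
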